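/- Let $N\ge 2$ and $c>0$. For a function $f$ of $r>0$ consider the vortex system $$\dot z_j=i f(|z_j|)z_j+ic\sum_{k\ne j}\frac{z_j-z_k}{|z_j-z_k|^2},\qquad z_j\in\mathbb C,\ j=1,\dots,N .$$ Let $R>0$, let $f$ be differentiable at $R$, and put $\omega=f(R)+\frac{c(N-1)}{2R^2}$. Then the ring $z_j(t)=e^{i\omega t}\xi_j$ with $\xi_j=Re^{2\pi i j/N}$ is a solution of the vortex system, and $\xi$ is an equilibrium of the aggregation system $\dot x_j=(f(|x_j|)-\omega)x_j+c\sum_{k\ne j}\frac{x_j-x_k}{|x_j-x_k|^2}$. The eigenvalues (with multiplicity) of the linearization of the aggregation system at $\xi$, a real-linear map on $\mathbb C^N\cong\mathbb R^{2N}$, are, for $m=0,\dots,N-1$, $$\lambda_+(m)=f'(R)R+\frac{c}{2R^2}\bigl[(m-1)(N-m-1)-(N-1)\bigr],\qquad \lambda_-(m)=\frac{c}{2R^2}\bigl[-(N-1)-(m-1)(N-m-1)\bigr].$$ Write $z_j=e^{i\omega t}x_j$, so that $\xi$ is an equilibrium of the vortex system in the variables $x$. Call the ring stable if all eigenvalues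 of the linearization at $\xi$ of the vortex system in these variables are purely imaginary (zero included) and the solutions of the linearized system stay bounded for $t\ge0$, by a constant times their initial size, modulo the direction $i\xi$ of infinitesimal rotations. Call it unstable if this linearization has an eigenvalue with positive real part. Set $$P=\begin{cases} f'(R)R+\dfrac{c}{8R^2}(N-1)(N-7), & N\text{ odd},\\[2mm] f'(R)R+\dfrac{c}{8R^2}(N^2-8N+8), & N\text{ even}.\end{cases}$$ Then the ring is stable if and only if $P<0$, and it is unstable if $P>0$. Consequently the ring is generically unstable if $N\ge7$ and $f$ is increasing: let $S\subseteq(0,\infty)$ be open and let $f$ be $C^1$ and strictly increasing on $S$. Then the ring of radius $R\in S$ is unstable whenever $N\ge8$ or $f'(R)>0$, and for every $N\ge7$ there is an open dense subset of $S$ such that the ring is unstable for every radius $R$ in it. -/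

import Mathlib

noncomputable section

/-- Velocity field of the `N`-vortex system
`dz_j/dt = i f(|z_j|) z_j + i c ∑_{k ≠ j} (z_j - z_k) / |z_j - z_k|²`. -/
def vortexField {N : ℕ} (f : ℝ → ℝ) (c : ℝ) (z : Fin N → ℂ) : Fin N → ℂ := fun j =>
  Complex.I * (f ‖z j‖ : ℂ) * z j +
    Complex.I * (c : ℂ) *
      ∑ k ∈ Finset.univ.erase j, (z j - z k) / ((‖z j - z k‖ ^ 2 : ℝ) : ℂ)

/-- The vortex system in the frame that rotates with angular velocity `ω`: `z_j = e^{iωt} x_j`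
solves the vortex system if and only if `x` solves `dx/dt = corotatingField f c ω x`. -/
def corotatingField {N : ℕ} (f : ℝ → ℝ) (c ω : ℝ) (x : Fin N → ℂ) : Fin N → ℂ := fun j =>
  vortexField f c x j - Complex.I * (ω : ℂ) * x j

/-- Velocity field of the aggregation system
`dx_j/dt = (f(|x_j|) - ω) x_j + c ∑_{k ≠ j} (x_j - x_k) / |x_j - x_k|²`. -/
def aggregationField {N : ℕ} (f : ℝ → ℝ) (c ω : ℝ) (x : Fin N → ℂ) : Fin N → ℂ := fun j =>
  ((f ‖x j‖ - ω : ℝ) : ℂ) * x j +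
    (c : ℂ) * ∑ k ∈ Finset.univ.erase j, (x j - x k) / ((‖x j - x k‖ ^ 2 : ℝ) : ℂ)

/-- The vertices of the regular `N`-gon of radius `R` centred at the origin. -/
def ringPolygon (N : ℕ) (R : ℝ) : Fin N → ℂ := fun j =>
  (R : ℂ) * Complex.exp (2 * (Real.pi : ℂ) * Complex.I / (N : ℂ) * ((j : ℕ) : ℂ))

/-- The polygon rotating rigidly with angular velocity `ω`. -/
def ringSolution (N : ℕ) (R ω : ℝ) (t : ℝ) : Fin N → ℂ := fun j =>
  Complex.exp (Complex.I * (ω : ℂ) * (t : ℂ)) * ringPolygon N R j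

/-- The angular velocity of the ring: `ω = f(R) + c (N - 1) / (2 R²)`. -/
def ringFrequency (N : ℕ) (f : ℝ → ℝ) (c R : ℝ) : ℝ :=
  f R + c * ((N : ℝ) - 1) / (2 * R ^ 2)

/-- `λ₊(m) = f'(R) R + c / (2 R²) [(m - 1)(N - m - 1) - (N - 1)]`. -/
def lambdaPlus (N : ℕ) (f : ℝ → ℝ) (c R : ℝ) (m : ℕ) : ℝ :=
  deriv f R * R +
    c / (2 * R ^ 2) * (((m : ℝ) - 1) * ((N : ℝ) - (m : ℝ) - 1) - ((N : ℝ) - 1))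

/-- `λ₋(m) = c / (2 R²) [-(N - 1) - (m - 1)(N - m - 1)]`. -/
def lambdaMinus (N : ℕ) (c R : ℝ) (m : ℕ) : ℝ :=
  c / (2 * R ^ 2) * (-((N : ℝ) - 1) - ((m : ℝ) - 1) * ((N : ℝ) - (m : ℝ) - 1))

/-- `μ` is an eigenvalue of (the complexification of) the real-linear map `L`. -/
def IsComplexEigenvalue {E : Type*} [NormedAddCommGroup E] [NormedSpace ℝ E]
    (L : E →L[ℝ] E) (μ : ℂ) : Prop :=
  Module.End.HasEigenvalue (LinearMap.baseChange ℂ (L : E →ₗ[ℝ] E)) μ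

/-- Neutral linear stability, up to a symmetry direction `v`, of the equilibrium `x` of
`dx/dt = F x`: all eigenvalues of the linearization `L` at `x` are purely imaginary, and the
solutions `η` of the linearized equation `dη/dt = L η` stay bounded for `t ≥ 0`, modulo
the line spanned by `v`, by a constant times their initial size. -/
def IsLinearlyStable {E : Type*} [NormedAddCommGroup E] [NormedSpace ℝ E]
    (F : E → E) (x v : E) : Prop :=
  ∃ L : E →L[ℝ] E, HasFDerivAt F L x ∧
    (∀ μ : ℂ, IsComplexEigenvalue L μ → μ.re = 0) ∧
    ∃ K : ℝ, ∀ η : ℝ → E, (∀ t : ℝ, HasDerivAt η (L (η t)) t) →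
      ∀ t : ℝ, 0 ≤ t → ∃ s : ℝ, ‖η t - s • v‖ ≤ K * ‖η 0‖

/-- Linear (exponential) instability of the equilibrium `x` of `dx/dt = F x`: the linearization
at `x` has an eigenvalue with positive real part. -/
def IsLinearlyUnstable {E : Type*} [NormedAddCommGroup E] [NormedSpace ℝ E]
    (F : E → E) (x : E) : Prop :=
  ∃ L : E →L[ℝ] E, HasFDerivAt F L x ∧ ∃ μ : ℂ, IsComplexEigenvalue L μ ∧ 0 < μ.re

/-- Linear stability of the ring as a relative equilibrium of the vortex system, i.e. modulo
the direction `i x` tangent to its orbit under rotations. -/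
def RingIsStable (N : ℕ) (f : ℝ → ℝ) (c R : ℝ) : Prop :=
  IsLinearlyStable (corotatingField (N := N) f c (ringFrequency N f c R))
    (ringPolygon N R) (Complex.I • ringPolygon N R)

/-- Linear instability of the ring as a relative equilibrium of the vortex system. -/
def RingIsUnstable (N : ℕ) (f : ℝ → ℝ) (c R : ℝ) : Prop :=
  IsLinearlyUnstable (corotatingField (N := N) f c (ringFrequency N f c R)) (ringPolygon N R)

end

/-! In the corotating frame the vortex field is `i` times the aggregation field
(`corotatingField_eq`), so the ring is an equilibrium of both and the vortex linearization is `L =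
iA`, with `A` the aggregation linearization. Since `z/|z|²` is the inverse of the conjugate of `z`,
`A` is only real-linear. Perturbations `ζ^j h_j` with `h` real are radial and those `i ζ^j h_j` are
tangential; `A` preserves both classes and acts on each by a circulant operator on `h`. Sums over
roots of unity (`sum_erase_hartleyMode`) diagonalize it with eigenvalues `λ₊(m)` and `λ₋(m)`.

Multiplication by `i` exchanges the two classes, so `L` splits into planes with `L e₀ = λ₊ e₁` and
`L e₁ = -λ₋ e₀`, hence `L² = -λ₊λ₋` on each. In mode `0`, `λ₋ = 0` and `e₁` is the rotation
direction; in every other mode `λ₋ < 0`. There `λ₊ < 0` gives an oscillator, `λ₊ = 0` linear growth,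
`λ₊ > 0` a positive eigenvalue (`isLinearlyStable_iff_of_pairing`). The largest `λ₊(m)` occurs at
`m` nearest `N/2` and equals `P`. -/

/-! ### Sums over roots of unity. -/

theorem IsPrimitiveRoot.pow_val_sub_ne_zero {N : ℕ} {ζ : ℂ} (hζ : IsPrimitiveRoot ζ N)
    {j k : Fin N} (h : k ≠ j) : ζ ^ (j : ℕ) - ζ ^ (k : ℕ) ≠ 0 := by
  intro h0
  exact h (Fin.ext (hζ.pow_inj k.2 j.2 (sub_eq_zero.mp h0).symm))

/-- The sum of the powers of an `N`-th root of unity. -/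
theorem sum_fin_pow_of_pow_eq_one {N : ℕ} {r : ℂ} (hr : r ^ N = 1) :
    ∑ j : Fin N, r ^ (j : ℕ) = if r = 1 then (N : ℂ) else 0 := by
  rw [Fin.sum_univ_eq_sum_range (fun i => r ^ i)]
  split_ifs with h
  · simp [h]
  · have := geom_sum_mul r N
    rw [hr, sub_self] at this
    exact (mul_eq_zero.mp this).resolve_right (sub_ne_zero.mpr h)

theorem IsPrimitiveRoot.pow_val_add {N : ℕ} {ζ : ℂ} (hζ : IsPrimitiveRoot ζ N)
    (a b : Fin N) : ζ ^ ((a + b : Fin N) : ℕ) = ζ ^ (a : ℕ) * ζ ^ (b : ℕ) := by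
  rw [Fin.val_add, ← pow_add, ← pow_mod_orderOf ζ (a + b : ℕ), ← hζ.eq_orderOf]

/-- The reflection `k ↦ 2j - k` modulo `N` sends `y = ζ^k` to `x²/y`, where `x = ζ^j`, and the terms
of `y` and `x²/y` add up to `1/x`. Averaging over the reflection leaves `N - 1` terms `1/(2x)`. -/
theorem IsPrimitiveRoot.sum_erase_inv_sub {N : ℕ} {ζ : ℂ} (hζ : IsPrimitiveRoot ζ N)
    (j : Fin N) :
    ∑ k ∈ Finset.univ.erase j, (ζ ^ (j : ℕ) - ζ ^ (k : ℕ))⁻¹ =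
      ((N : ℂ) - 1) / (2 * ζ ^ (j : ℕ)) := by
  have hN : NeZero N := ⟨fun h => by subst h; exact j.elim0⟩
  have hζ0 : ζ ≠ 0 := hζ.ne_zero hN.out
  set x := ζ ^ (j : ℕ) with hx
  have hx0 : x ≠ 0 := pow_ne_zero _ hζ0
  have hrefl : ∑ k ∈ Finset.univ.erase j, (x - ζ ^ (k : ℕ))⁻¹ =
      ∑ k ∈ Finset.univ.erase j, (x - ζ ^ ((j + j - k : Fin N) : ℕ))⁻¹ := by
    symm
    refine Finset.sum_nbij' (fun k => j + j - k) (fun k => j + j - k) ?_ ?_ ?_ ?_ ?_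
    · intro k hk
      simp only [Finset.mem_erase, Finset.mem_univ, and_true] at hk ⊢
      intro h
      exact hk (by rw [sub_eq_iff_eq_add] at h; exact (add_left_cancel h).symm)
    · intro k hk
      simp only [Finset.mem_erase, Finset.mem_univ, and_true] at hk ⊢
      intro h
      exact hk (by rw [sub_eq_iff_eq_add] at h; exact (add_left_cancel h).symm)
    · intro k _; exact sub_sub_cancel _ _
    · intro k _; exact sub_sub_cancel _ _
    · intro k _; rfl
  have hterm : ∀ k ∈ Finset.univ.erase j,
      (x - ζ ^ (k : ℕ))⁻¹ + (x - ζ ^ ((j + j - k : Fin N) : ℕ))⁻¹ = x⁻¹ := by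
    intro k hk
    have hkj : k ≠ j := Finset.ne_of_mem_erase hk
    have h1 := hζ.pow_val_sub_ne_zero hkj
    have hy0 : ζ ^ (k : ℕ) ≠ 0 := pow_ne_zero _ hζ0
    have hmul : ζ ^ ((j + j - k : Fin N) : ℕ) = x * x / ζ ^ (k : ℕ) := by
      rw [eq_div_iff hy0, ← hζ.pow_val_add, sub_add_cancel, hζ.pow_val_add]
    rw [hmul]
    rw [← hx] at h1
    set y := ζ ^ (k : ℕ)
    have h2 : x - x * x / y = -(x * (x - y)) / y := by field_simp; ring
    rw [h2]
    field_simp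
    ring
  have h2 : 2 * ∑ k ∈ Finset.univ.erase j, (x - ζ ^ (k : ℕ))⁻¹ = ((N : ℂ) - 1) * x⁻¹ := by
    rw [two_mul]
    nth_rewrite 2 [hrefl]
    rw [← Finset.sum_add_distrib, Finset.sum_congr rfl hterm]
    simp [Finset.card_erase_of_mem, Nat.cast_sub (Nat.one_le_iff_ne_zero.mpr hN.out)]
  rw [eq_div_iff (by simpa using hx0)]
  linear_combination x * h2 + ((N : ℂ) - 1) * (mul_inv_cancel₀ hx0)

theorem IsPrimitiveRoot.sum_erase_pow_div_sub {N : ℕ} {ζ : ℂ} (hζ : IsPrimitiveRoot ζ N)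
    (j : Fin N) {n : ℕ} (hn : n + 1 ≤ N) :
    ∑ k ∈ Finset.univ.erase j, (ζ ^ (k : ℕ)) ^ (n + 1) / (ζ ^ (j : ℕ) - ζ ^ (k : ℕ)) =
      (ζ ^ (j : ℕ)) ^ n * ((n : ℂ) - ((N : ℂ) - 1) / 2) := by
  have hN : N ≠ 0 := by omega
  set x := ζ ^ (j : ℕ) with hx
  have hx0 : x ≠ 0 := pow_ne_zero _ (hζ.ne_zero hN)
  -- From `y^(n+1)/(x - y) = x y^n/(x - y) - y^n`. The full power sum of the `y^n` is `N` for `n =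
  -- 0` and vanishes for `0 < n < N`.
  have step : ∀ n : ℕ, ∑ k ∈ Finset.univ.erase j, (ζ ^ (k : ℕ)) ^ (n + 1) / (x - ζ ^ (k : ℕ)) =
      x * ∑ k ∈ Finset.univ.erase j, (ζ ^ (k : ℕ)) ^ n / (x - ζ ^ (k : ℕ)) -
        (∑ k : Fin N, (ζ ^ n) ^ (k : ℕ) - x ^ n) := by
    intro n
    rw [← Finset.add_sum_erase _ _ (Finset.mem_univ j), ← pow_mul, mul_comm n, pow_mul, ← hx,
      add_sub_cancel_left, Finset.mul_sum, ← Finset.sum_sub_distrib]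
    refine Finset.sum_congr rfl fun k hk => ?_
    have h1 := hζ.pow_val_sub_ne_zero (Finset.ne_of_mem_erase hk)
    rw [← hx] at h1
    rw [pow_right_comm ζ n]
    field_simp
    ring
  induction n with
  | zero =>
    rw [step 0]
    have := hζ.sum_erase_inv_sub j
    rw [← hx] at this
    simp only [pow_zero, one_div, this, one_pow, Finset.sum_const, Finset.card_univ,
      Fintype.card_fin, nsmul_eq_mul, mul_one, CharP.cast_eq_zero]
    field_simp
    ring
  | succ n ih =>
    rw [step (n + 1), ih (by omega), sum_fin_pow_of_pow_eq_one, if_neg]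
    · push_cast; ring
    · exact hζ.pow_ne_one_of_pos_of_lt (by omega) (by omega)
    · rw [← pow_mul, mul_comm, pow_mul, hζ.pow_eq_one, one_pow]

/-- Fourier modes diagonalize the linearized interaction. The induction peels off one factor of `x`:
the remainder is a sum of `y^(m+1)/(x - y)`, evaluated in `sum_erase_pow_div_sub`. -/
theorem IsPrimitiveRoot.sum_erase_pow_sub_pow_div_sq {N : ℕ} {ζ : ℂ} (hζ : IsPrimitiveRoot ζ N)
    (j : Fin N) {m : ℕ} (hm : m < N) :
    ζ ^ (j : ℕ) * ∑ k ∈ Finset.univ.erase j,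
      (ζ ^ (j : ℕ) * (ζ ^ (j : ℕ)) ^ m - ζ ^ (k : ℕ) * (ζ ^ (k : ℕ)) ^ m) /
        (ζ ^ (j : ℕ) - ζ ^ (k : ℕ)) ^ 2 =
      -(((m : ℂ) - 1) * ((N : ℂ) - m - 1) / 2) * (ζ ^ (j : ℕ)) ^ m := by
  have hN : N ≠ 0 := by omega
  set x := ζ ^ (j : ℕ) with hx
  have hx0 : x ≠ 0 := pow_ne_zero _ (hζ.ne_zero hN)
  induction m with
  | zero =>
    have : ∀ k ∈ Finset.univ.erase j, (x * x ^ 0 - ζ ^ (k : ℕ) * (ζ ^ (k : ℕ)) ^ 0) /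
        (x - ζ ^ (k : ℕ)) ^ 2 = (x - ζ ^ (k : ℕ))⁻¹ := by
      intro k hk
      have h1 := hζ.pow_val_sub_ne_zero (Finset.ne_of_mem_erase hk)
      rw [← hx] at h1
      field_simp
    rw [Finset.sum_congr rfl this, hζ.sum_erase_inv_sub, ← hx]
    field_simp
    push_cast
    ring
  | succ m ih =>
    have : ∀ k ∈ Finset.univ.erase j, (x * x ^ (m + 1) - ζ ^ (k : ℕ) * (ζ ^ (k : ℕ)) ^ (m + 1)) /
        (x - ζ ^ (k : ℕ)) ^ 2 = x * ((x * x ^ m - ζ ^ (k : ℕ) * (ζ ^ (k : ℕ)) ^ m) /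
        (x - ζ ^ (k : ℕ)) ^ 2) + (ζ ^ (k : ℕ)) ^ (m + 1) / (x - ζ ^ (k : ℕ)) := by
      intro k hk
      have h1 := hζ.pow_val_sub_ne_zero (Finset.ne_of_mem_erase hk)
      rw [← hx] at h1
      field_simp
      ring
    rw [Finset.sum_congr rfl this, Finset.sum_add_distrib, ← Finset.mul_sum, ih (by omega),
      hζ.sum_erase_pow_div_sub j (by omega), ← hx]
    push_cast
    ring

theorem IsPrimitiveRoot.conj_eq_inv {N : ℕ} {ζ : ℂ} (hζ : IsPrimitiveRoot ζ N) (hN : N ≠ 0) :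
    (starRingEnd ℂ) ζ = ζ⁻¹ :=
  (Complex.inv_eq_conj (Complex.norm_eq_one_of_pow_eq_one hζ.pow_eq_one hN)).symm

theorem IsPrimitiveRoot.sum_erase_conj_pow_div_sq {N : ℕ} {ζ : ℂ} (hζ : IsPrimitiveRoot ζ N)
    (j : Fin N) {m : ℕ} (hm : m < N) :
    ζ ^ (j : ℕ) * ∑ k ∈ Finset.univ.erase j,
      (ζ ^ (j : ℕ) * (starRingEnd ℂ) ((ζ ^ (j : ℕ)) ^ m) -
        ζ ^ (k : ℕ) * (starRingEnd ℂ) ((ζ ^ (k : ℕ)) ^ m)) / (ζ ^ (j : ℕ) - ζ ^ (k : ℕ)) ^ 2 =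
      -(((m : ℂ) - 1) * ((N : ℂ) - m - 1) / 2) * (starRingEnd ℂ) ((ζ ^ (j : ℕ)) ^ m) := by
  have hN : N ≠ 0 := by omega
  -- Conjugating mode `m` gives mode `N - m`, and the eigenvalue is symmetric under this exchange.
  -- Mode `0` is its own conjugate; there `N - m` would leave the admissible range.
  rcases Nat.eq_zero_or_pos m with rfl | hm0
  · simpa using hζ.sum_erase_pow_sub_pow_div_sq j hm
  · have key : ∀ k : Fin N, (starRingEnd ℂ) ((ζ ^ (k : ℕ)) ^ m) = (ζ ^ (k : ℕ)) ^ (N - m) := by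
      intro k
      rw [map_pow, map_pow, hζ.conj_eq_inv hN, inv_pow, inv_pow, inv_eq_iff_eq_inv]
      refine eq_inv_of_mul_eq_one_left ?_
      rw [← pow_add, Nat.add_sub_cancel' hm.le, ← pow_mul, mul_comm, pow_mul, hζ.pow_eq_one,
        one_pow]
    simp only [key]
    rw [hζ.sum_erase_pow_sub_pow_div_sq j (by omega), Nat.cast_sub hm.le]
    ring

/-! ### Hartley modes and the adapted real basis. -/

noncomputable section

/-- The Hartley mode `cos (2π m j / N) + sin (2π m j / N)`, where `ζ = e^{2πi/N}`. -/
def hartleyMode {N : ℕ} (ζ : ℂ) (m j : Fin N) : ℝ :=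
  ((ζ ^ (j : ℕ)) ^ (m : ℕ)).re + ((ζ ^ (j : ℕ)) ^ (m : ℕ)).im

theorem hartleyMode_zero {N : ℕ} (ζ : ℂ) (m j : Fin N) (hj : (m : ℕ) = 0) :
    hartleyMode ζ m j = 1 := by
  simp [hartleyMode, hj]

theorem hartleyMode_eq {N : ℕ} (ζ : ℂ) (m j : Fin N) :
    (hartleyMode ζ m j : ℂ) = (1 - Complex.I) / 2 * (ζ ^ (j : ℕ)) ^ (m : ℕ) +
      (1 + Complex.I) / 2 * (starRingEnd ℂ) ((ζ ^ (j : ℕ)) ^ (m : ℕ)) := by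
  rw [hartleyMode]
  generalize (ζ ^ (j : ℕ)) ^ (m : ℕ) = z
  apply Complex.ext <;> simp <;> ring

/-- Hartley modes diagonalize the interaction of the vertices of the regular polygon. -/
theorem IsPrimitiveRoot.sum_erase_hartleyMode {N : ℕ} {ζ : ℂ} (hζ : IsPrimitiveRoot ζ N)
    (m j : Fin N) :
    ζ ^ (j : ℕ) * ∑ k ∈ Finset.univ.erase j,
      (ζ ^ (j : ℕ) * (hartleyMode ζ m j : ℂ) - ζ ^ (k : ℕ) * (hartleyMode ζ m k : ℂ)) /
        (ζ ^ (j : ℕ) - ζ ^ (k : ℕ)) ^ 2 =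
      -(((m : ℂ) - 1) * ((N : ℂ) - (m : ℂ) - 1) / 2) * (hartleyMode ζ m j : ℂ) := by
  have h1 := hζ.sum_erase_pow_sub_pow_div_sq j m.2
  have h2 := hζ.sum_erase_conj_pow_div_sq j m.2
  have h3 : ∀ k ∈ Finset.univ.erase j,
      (ζ ^ (j : ℕ) * (hartleyMode ζ m j : ℂ) - ζ ^ (k : ℕ) * (hartleyMode ζ m k : ℂ)) /
        (ζ ^ (j : ℕ) - ζ ^ (k : ℕ)) ^ 2 =
      (1 - Complex.I) / 2 * ((ζ ^ (j : ℕ) * (ζ ^ (j : ℕ)) ^ (m : ℕ) -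
        ζ ^ (k : ℕ) * (ζ ^ (k : ℕ)) ^ (m : ℕ)) / (ζ ^ (j : ℕ) - ζ ^ (k : ℕ)) ^ 2) +
      (1 + Complex.I) / 2 * ((ζ ^ (j : ℕ) * (starRingEnd ℂ) ((ζ ^ (j : ℕ)) ^ (m : ℕ)) -
        ζ ^ (k : ℕ) * (starRingEnd ℂ) ((ζ ^ (k : ℕ)) ^ (m : ℕ))) /
          (ζ ^ (j : ℕ) - ζ ^ (k : ℕ)) ^ 2) := by
    intro k _
    rw [hartleyMode_eq, hartleyMode_eq]
    ring
  rw [Finset.sum_congr rfl h3, Finset.sum_add_distrib, ← Finset.mul_sum, ← Finset.mul_sum,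
    hartleyMode_eq]
  linear_combination (1 - Complex.I) / 2 * h1 + (1 + Complex.I) / 2 * h2

/-- The product of modes `l` and `m` at `j` is `Re ζ^(j(l-m)) + Im ζ^(j(l+m))`. The second part sums
to the imaginary part of `N` or `0`, hence to zero. Hartley modes thus give one real mode per index,
without pairing cosines with sines. -/
theorem IsPrimitiveRoot.sum_hartleyMode_mul {N : ℕ} {ζ : ℂ} (hζ : IsPrimitiveRoot ζ N)
    (l m : Fin N) :
    ∑ j : Fin N, hartleyMode ζ l j * hartleyMode ζ m j = if l = m then (N : ℝ) else 0 := by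
  have hN : N ≠ 0 := fun h => by subst h; exact l.elim0
  have hζ0 := hζ.ne_zero hN
  have e1 : ∀ j : Fin N, hartleyMode ζ l j * hartleyMode ζ m j =
      ((ζ ^ (l : ℕ) * (ζ ^ (m : ℕ))⁻¹) ^ (j : ℕ)).re + ((ζ ^ ((l : ℕ) + m)) ^ (j : ℕ)).im := by
    intro j
    have h1 : (ζ ^ (l : ℕ) * (ζ ^ (m : ℕ))⁻¹) ^ (j : ℕ) =
        (ζ ^ (j : ℕ)) ^ (l : ℕ) * (starRingEnd ℂ) ((ζ ^ (j : ℕ)) ^ (m : ℕ)) := by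
      rw [map_pow, map_pow, hζ.conj_eq_inv hN, mul_pow, pow_right_comm, inv_pow, inv_pow, inv_pow,
        pow_right_comm ζ (m : ℕ)]
    have h2 : (ζ ^ ((l : ℕ) + m)) ^ (j : ℕ) = (ζ ^ (j : ℕ)) ^ (l : ℕ) * (ζ ^ (j : ℕ)) ^ (m : ℕ) := by
      rw [pow_right_comm, pow_add]
    rw [h1, h2, hartleyMode, hartleyMode]
    simp only [Complex.mul_re, Complex.mul_im, Complex.conj_re, Complex.conj_im]
    ring
  have hp : ∀ n : ℕ, (ζ ^ n) ^ N = 1 := fun n => by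
    rw [pow_right_comm, hζ.pow_eq_one, one_pow]
  rw [Finset.sum_congr rfl fun j _ => e1 j, Finset.sum_add_distrib, ← Complex.re_sum,
    ← Complex.im_sum, sum_fin_pow_of_pow_eq_one (hp _), sum_fin_pow_of_pow_eq_one (by
      rw [mul_pow, inv_pow, hp, hp]; simp)]
  have h3 : ζ ^ (l : ℕ) * (ζ ^ (m : ℕ))⁻¹ = 1 ↔ l = m := by
    rw [mul_inv_eq_one₀ (pow_ne_zero _ hζ0)]
    exact ⟨fun h => Fin.ext (hζ.pow_inj l.2 m.2 h), fun h => by rw [h]⟩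
  simp only [h3]
  split_ifs <;> simp

/-- The Hartley modes in the frame of the regular polygon with vertices `ζ ^ j`. -/
def polygonMode {N : ℕ} (ζ : ℂ) (m j : Fin N) : ℂ := ζ ^ (j : ℕ) * (hartleyMode ζ m j : ℂ)

theorem IsPrimitiveRoot.linearIndependent_polygonMode {N : ℕ} {ζ : ℂ}
    (hζ : IsPrimitiveRoot ζ N) : LinearIndependent ℂ (polygonMode (N := N) ζ) := by
  rw [Fintype.linearIndependent_iff]
  intro g hg m
  have hN : N ≠ 0 := fun h => by subst h; exact m.elim0
  have hζ0 := hζ.ne_zero hN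
  have h1 : ∀ j : Fin N, ∑ l, g l * (hartleyMode ζ l j : ℂ) = 0 := by
    intro j
    have h := congrFun hg j
    simp only [Finset.sum_apply, Pi.smul_apply, smul_eq_mul, polygonMode, Pi.zero_apply] at h
    simp only [mul_left_comm (g _), ← Finset.mul_sum] at h
    exact (mul_eq_zero.mp h).resolve_left (pow_ne_zero _ hζ0)
  have h2 : ∑ j : Fin N, (∑ l, g l * (hartleyMode ζ l j : ℂ)) * (hartleyMode ζ m j : ℂ) = 0 := by
    simp [h1]
  simp only [Finset.sum_mul] at h2
  rw [Finset.sum_comm] at h2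
  have h3 : ∀ l : Fin N, ∑ j : Fin N, g l * (hartleyMode ζ l j : ℂ) * (hartleyMode ζ m j : ℂ) =
      g l * ((if l = m then (N : ℝ) else 0 : ℝ) : ℂ) := by
    intro l
    rw [← hζ.sum_hartleyMode_mul l m, Complex.ofReal_sum, Finset.mul_sum]
    exact Finset.sum_congr rfl fun j _ => by push_cast; ring
  rw [Finset.sum_congr rfl fun l _ => h3 l, Finset.sum_eq_single m] at h2
  · simpa [hN] using h2
  · intro l _ hl; simp [hl]
  · simp

/-- The real basis of `ℂ ^ N` of the modes `polygonMode` and their multiples by `i`. -/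
def IsPrimitiveRoot.polygonBasis {N : ℕ} [NeZero N] {ζ : ℂ} (hζ : IsPrimitiveRoot ζ N) :
    Module.Basis (Fin 2 × Fin N) ℝ (Fin N → ℂ) :=
  Complex.basisOneI.smulTower
    (basisOfLinearIndependentOfCardEqFinrank hζ.linearIndependent_polygonMode (by simp))

theorem IsPrimitiveRoot.polygonBasis_zero {N : ℕ} [NeZero N] {ζ : ℂ} (hζ : IsPrimitiveRoot ζ N)
    (m : Fin N) : hζ.polygonBasis (0, m) = polygonMode ζ m := by
  simp [IsPrimitiveRoot.polygonBasis, Module.Basis.smulTower_apply]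

theorem IsPrimitiveRoot.polygonBasis_one {N : ℕ} [NeZero N] {ζ : ℂ} (hζ : IsPrimitiveRoot ζ N)
    (m : Fin N) : hζ.polygonBasis (1, m) = Complex.I • polygonMode ζ m := by
  simp [IsPrimitiveRoot.polygonBasis, Module.Basis.smulTower_apply]

end

/-! ### The aggregation field: equilibrium and linearization. -/

theorem div_norm_sq_eq_inv_conj (z : ℂ) : z / ((‖z‖ ^ 2 : ℝ) : ℂ) = ((starRingEnd ℂ) z)⁻¹ := by
  rw [Complex.inv_def, Complex.conj_conj, Complex.normSq_conj, Complex.normSq_eq_norm_sq,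
    div_eq_mul_inv]
  push_cast
  rfl

theorem corotatingField_eq {N : ℕ} (f : ℝ → ℝ) (c ω : ℝ) :
    corotatingField (N := N) f c ω = fun x => Complex.I • aggregationField f c ω x := by
  funext x j
  simp only [corotatingField, vortexField, aggregationField, Pi.smul_apply, smul_eq_mul]
  push_cast
  ring

theorem differentiableAt_aggregationField {N : ℕ} {f : ℝ → ℝ} {c ω : ℝ} {z : Fin N → ℂ}
    (hz : ∀ j, z j ≠ 0) (hinj : Function.Injective z)
    (hf : ∀ j, DifferentiableAt ℝ f ‖z j‖) :
    DifferentiableAt ℝ (aggregationField f c ω) z := by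
  rw [differentiableAt_pi]
  intro j
  have hp : ∀ k : Fin N, DifferentiableAt ℝ (fun x : Fin N → ℂ => x k) z := fun k =>
    differentiableAt_apply k z
  have hn : DifferentiableAt ℝ (fun x : Fin N → ℂ => f ‖x j‖ - ω) z :=
    ((hf j).comp z ((hp j).norm ℝ (hz j))).sub_const ω
  have h1 : DifferentiableAt ℝ (fun x : Fin N → ℂ => ((f ‖x j‖ - ω : ℝ) : ℂ)) z :=
    Complex.ofRealCLM.differentiableAt.comp z hn
  simp only [aggregationField, div_norm_sq_eq_inv_conj]
  refine (h1.mul (hp j)).add (DifferentiableAt.const_mul (DifferentiableAt.fun_sum ?_) _)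
  intro k hk
  have hjk : z j - z k ≠ 0 := sub_ne_zero.mpr fun h => Finset.ne_of_mem_erase hk (hinj h).symm
  exact DifferentiableAt.inv (DifferentiableAt.star ((hp j).sub (hp k)))
    ((map_ne_zero (starRingEnd ℂ)).mpr hjk)

/-- Differentiability being known separately, derivatives along lines determine the linearization.
The conjugate in the last term comes from differentiating the antiholomorphic interaction. -/
theorem hasDerivAt_aggregationField_line {N : ℕ} {f : ℝ → ℝ} {c ω : ℝ} {z : Fin N → ℂ}
    (hz : ∀ j, z j ≠ 0) (hinj : Function.Injective z)
    (hf : ∀ j, DifferentiableAt ℝ f ‖z j‖) (v : Fin N → ℂ) (j : Fin N) :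
    HasDerivAt (fun t : ℝ => aggregationField f c ω (z + t • v) j)
      (((deriv f ‖z j‖ * (inner ℝ (z j) (v j) / ‖z j‖) : ℝ) : ℂ) * z j +
        ((f ‖z j‖ - ω : ℝ) : ℂ) * v j -
        (c : ℂ) * (starRingEnd ℂ) (∑ k ∈ Finset.univ.erase j,
          (v j - v k) / (z j - z k) ^ 2)) 0 := by
  have hp : ∀ k : Fin N, HasDerivAt (fun t : ℝ => (z + t • v) k) (v k) 0 := by
    intro k
    simpa using ((hasDerivAt_id (0 : ℝ)).smul_const (v k)).const_add (z k)
  have hnorm : HasDerivAt (fun t : ℝ => ‖(z + t • v) j‖) (inner ℝ (z j) (v j) / ‖z j‖) 0 := by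
    have h := (hp j).norm_sq.sqrt (by simpa using hz j)
    simp only [zero_smul, add_zero, Real.sqrt_sq (norm_nonneg _)] at h
    convert h using 1
    rw [mul_div_mul_left _ _ two_ne_zero]
  have hfn : HasDerivAt (fun t : ℝ => ((f ‖(z + t • v) j‖ - ω : ℝ) : ℂ))
      ((deriv f ‖z j‖ * (inner ℝ (z j) (v j) / ‖z j‖) : ℝ) : ℂ) 0 := by
    refine HasDerivAt.ofReal_comp (HasDerivAt.sub_const ω ?_)
    refine HasDerivAt.comp (h₂ := f) (h := fun t : ℝ => ‖(z + t • v) j‖) 0 ?_ hnorm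
    simpa using (hf j).hasDerivAt
  have hterm : ∀ k ∈ Finset.univ.erase j,
      HasDerivAt (fun t : ℝ => ((starRingEnd ℂ) ((z + t • v) j - (z + t • v) k))⁻¹)
        (-(starRingEnd ℂ) ((v j - v k) / (z j - z k) ^ 2)) 0 := by
    intro k hk
    have hjk : z j - z k ≠ 0 := sub_ne_zero.mpr fun h => Finset.ne_of_mem_erase hk (hinj h).symm
    have h1 : HasDerivAt (fun t : ℝ => (starRingEnd ℂ) ((z + t • v) j - (z + t • v) k))
        ((starRingEnd ℂ) (v j - v k)) 0 := ((hp j).sub (hp k)).star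
    have h2 : (starRingEnd ℂ) ((z + (0 : ℝ) • v) j - (z + (0 : ℝ) • v) k) ≠ 0 :=
      (map_ne_zero (starRingEnd ℂ)).mpr (by simpa using hjk)
    refine (h1.fun_inv h2).congr_deriv ?_
    simp only [zero_smul, add_zero, map_sub, map_div₀, map_pow]
    ring
  have := (hfn.mul (hp j)).add ((HasDerivAt.fun_sum hterm).const_mul (c : ℂ))
  simp only [aggregationField, div_norm_sq_eq_inv_conj]
  refine this.congr_deriv ?_
  simp only [Finset.sum_neg_distrib, map_sum, zero_smul, add_zero]
  ring

theorem ringPolygon_eq (N : ℕ) (R : ℝ) (j : Fin N) :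
    ringPolygon N R j =
      (R : ℂ) * Complex.exp (2 * (Real.pi : ℂ) * Complex.I / (N : ℂ)) ^ (j : ℕ) := by
  rw [ringPolygon, ← Complex.exp_nat_mul, mul_comm ((j : ℕ) : ℂ)]

theorem aggregationField_polygon_eq_zero {N : ℕ} {ζ : ℂ} (hζ : IsPrimitiveRoot ζ N)
    (f : ℝ → ℝ) (c : ℝ) {R : ℝ} (hR : 0 < R) :
    aggregationField f c (ringFrequency N f c R) (fun j : Fin N => (R : ℂ) * ζ ^ (j : ℕ)) = 0 := by
  funext j
  have hN : N ≠ 0 := fun h => by subst h; exact j.elim0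
  have hn : ‖ζ‖ = 1 := Complex.norm_eq_one_of_pow_eq_one hζ.pow_eq_one hN
  have hζ0 : ζ ≠ 0 := hζ.ne_zero hN
  have hR0 : (R : ℂ) ≠ 0 := by exact_mod_cast hR.ne'
  have h := congrArg (starRingEnd ℂ) (hζ.sum_erase_inv_sub j)
  simp only [map_sum, map_inv₀, map_div₀, map_mul, map_pow, map_sub, map_natCast, map_one,
    map_ofNat, hζ.conj_eq_inv hN] at h
  simp only [aggregationField, div_norm_sq_eq_inv_conj, ← mul_sub, map_mul, Complex.conj_ofReal,
    mul_inv (R : ℂ), ← Finset.mul_sum, map_sub, map_pow, hζ.conj_eq_inv hN, h, Pi.zero_apply]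
  rw [norm_mul, norm_pow, hn, one_pow, mul_one, Complex.norm_real, Real.norm_of_nonneg hR.le,
    ringFrequency]
  push_cast
  have hp : ζ ^ (j : ℕ) ≠ 0 := pow_ne_zero _ hζ0
  rw [inv_pow]
  field_simp
  ring

/-- The linearization of the aggregation system at the ring, diagonalized in `polygonBasis`. -/
theorem exists_hasFDerivAt_aggregationField {N : ℕ} {ζ : ℂ} (hζ : IsPrimitiveRoot ζ N)
    (hN : N ≠ 0) {f : ℝ → ℝ} (c : ℝ) {R : ℝ} (hR : 0 < R) (hf : DifferentiableAt ℝ f R) :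
    ∃ A : (Fin N → ℂ) →L[ℝ] (Fin N → ℂ),
      HasFDerivAt (aggregationField f c (ringFrequency N f c R)) A
        (fun j : Fin N => (R : ℂ) * ζ ^ (j : ℕ)) ∧
      (∀ m : Fin N, A (polygonMode ζ m) = lambdaPlus N f c R m • polygonMode ζ m) ∧
      ∀ m : Fin N, A (Complex.I • polygonMode ζ m) =
        lambdaMinus N c R m • Complex.I • polygonMode ζ m := by
  set z : Fin N → ℂ := fun j => (R : ℂ) * ζ ^ (j : ℕ) with hzdef
  have hn : ‖ζ‖ = 1 := Complex.norm_eq_one_of_pow_eq_one hζ.pow_eq_one hN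
  have hζ0 : ζ ≠ 0 := hζ.ne_zero hN
  have hR0 : (R : ℂ) ≠ 0 := by exact_mod_cast hR.ne'
  have hz : ∀ j, z j ≠ 0 := fun j => mul_ne_zero hR0 (pow_ne_zero _ hζ0)
  have hinj : Function.Injective z := fun j k h =>
    Fin.ext (hζ.pow_inj j.2 k.2 (mul_left_cancel₀ hR0 h))
  have hzn : ∀ j, ‖z j‖ = R := fun j => by
    simp [hzdef, hn, abs_of_pos hR]
  have hf' : ∀ j, DifferentiableAt ℝ f ‖z j‖ := fun j => by rwa [hzn]
  have hconj : ∀ j : Fin N, (starRingEnd ℂ) (ζ ^ (j : ℕ)) * ζ ^ (j : ℕ) = 1 := fun j => by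
    rw [map_pow, hζ.conj_eq_inv hN, ← mul_pow, inv_mul_cancel₀ hζ0, one_pow]
  have hA := (differentiableAt_aggregationField (c := c) (ω := ringFrequency N f c R)
    hz hinj hf').hasFDerivAt
  refine ⟨_, hA, ?_⟩
  have hline : ∀ (v : Fin N → ℂ) (j : Fin N),
      fderiv ℝ (aggregationField f c (ringFrequency N f c R)) z v j =
      ((deriv f R * (inner ℝ (z j) (v j) / R) : ℝ) : ℂ) * z j +
        ((f R - ringFrequency N f c R : ℝ) : ℂ) * v j -
        (c : ℂ) * (starRingEnd ℂ) (∑ k ∈ Finset.univ.erase j,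
          (v j - v k) / (z j - z k) ^ 2) := by
    intro v j
    have h1 : HasDerivAt (fun t : ℝ => z + t • v) v 0 := by
      simpa using ((hasDerivAt_id (0 : ℝ)).smul_const v).const_add z
    have h2 : HasDerivAt (fun t : ℝ => aggregationField f c (ringFrequency N f c R) (z + t • v))
        (fderiv ℝ (aggregationField f c (ringFrequency N f c R)) z v) 0 := by
      refine HasFDerivAt.comp_hasDerivAt
        (l := aggregationField f c (ringFrequency N f c R)) (0 : ℝ) ?_ h1
      simpa using hA
    have h3 := hasDerivAt_aggregationField_line (c := c) (ω := ringFrequency N f c R) hz hinj hf' v j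
    rw [hzn] at h3
    exact (hasDerivAt_pi.mp h2 j).unique h3
  -- The eigenvalue relation for `hartleyMode` is conjugated: its right side is real, and the
  -- prefactor `ζ^j` becomes its inverse, which moves over to rebuild `polygonMode`.
  have hsum : ∀ m j : Fin N, (starRingEnd ℂ) (∑ k ∈ Finset.univ.erase j,
      (polygonMode ζ m j - polygonMode ζ m k) / (z j - z k) ^ 2) =
      -(((m : ℂ) - 1) * ((N : ℂ) - (m : ℂ) - 1) / (2 * R ^ 2)) * polygonMode ζ m j := by
    intro m j
    have h := congrArg (starRingEnd ℂ) (hζ.sum_erase_hartleyMode m j)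
    have h2 : ∑ k ∈ Finset.univ.erase j,
        (polygonMode ζ m j - polygonMode ζ m k) / (z j - z k) ^ 2 = ((R : ℂ) ^ 2)⁻¹ *
        ∑ k ∈ Finset.univ.erase j,
          (ζ ^ (j : ℕ) * (hartleyMode ζ m j : ℂ) - ζ ^ (k : ℕ) * (hartleyMode ζ m k : ℂ)) /
          (ζ ^ (j : ℕ) - ζ ^ (k : ℕ)) ^ 2 := by
      rw [Finset.mul_sum]
      refine Finset.sum_congr rfl fun k _ => ?_
      simp only [hzdef, polygonMode, ← mul_sub, mul_pow]
      rw [div_mul_eq_div_div_swap, div_eq_inv_mul _ ((R : ℂ) ^ 2)]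
    rw [h2, map_mul]
    rw [map_mul] at h
    generalize (starRingEnd ℂ) (∑ k ∈ Finset.univ.erase j, _) = s at h ⊢
    simp only [map_mul, map_neg, map_div₀, map_sub, map_natCast, map_one, map_ofNat, map_inv₀,
      map_pow, Complex.conj_ofReal] at h ⊢
    have hc := hconj j
    rw [map_pow] at hc
    rw [polygonMode]
    field_simp
    linear_combination (2 * ζ ^ (j : ℕ)) * h - 2 * s * hc
  constructor
  · intro m
    funext j
    rw [hline, hsum]
    have hin : inner ℝ (z j) (polygonMode ζ m j) = R * hartleyMode ζ m j := by
      rw [Complex.inner]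
      simp only [hzdef, polygonMode]
      rw [map_mul, Complex.conj_ofReal,
        show ζ ^ (j : ℕ) * (hartleyMode ζ m j : ℂ) * ((R : ℂ) * (starRingEnd ℂ) (ζ ^ (j : ℕ))) =
          (R : ℂ) * ((starRingEnd ℂ) (ζ ^ (j : ℕ)) * ζ ^ (j : ℕ)) * (hartleyMode ζ m j : ℂ) by ring,
        hconj, mul_one, ← Complex.ofReal_mul, Complex.ofReal_re]
    rw [hin, mul_div_cancel_left₀ _ hR.ne', Pi.smul_apply, Complex.real_smul, lambdaPlus,
      ringFrequency]
    simp only [hzdef, polygonMode]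
    push_cast
    field_simp
    ring
  · intro m
    funext j
    have hI : ∑ k ∈ Finset.univ.erase j, ((Complex.I • polygonMode ζ m) j -
        (Complex.I • polygonMode ζ m) k) / (z j - z k) ^ 2 = Complex.I *
        ∑ k ∈ Finset.univ.erase j,
          (polygonMode ζ m j - polygonMode ζ m k) / (z j - z k) ^ 2 := by
      rw [Finset.mul_sum]
      refine Finset.sum_congr rfl fun k _ => ?_
      simp only [Pi.smul_apply, smul_eq_mul]
      ring
    -- Conjugation turns `i` into `-i`, so the interaction changes sign on tangential modes; the
    -- `f'` term drops out because these modes are orthogonal to the radius.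
    rw [hline, hI, map_mul, hsum, Complex.conj_I]
    have hin : inner ℝ (z j) ((Complex.I • polygonMode ζ m) j) = 0 := by
      rw [Complex.inner]
      simp only [hzdef, polygonMode, Pi.smul_apply, smul_eq_mul]
      rw [map_mul, Complex.conj_ofReal,
        show Complex.I * (ζ ^ (j : ℕ) * (hartleyMode ζ m j : ℂ)) *
            ((R : ℂ) * (starRingEnd ℂ) (ζ ^ (j : ℕ))) =
          (R : ℂ) * ((starRingEnd ℂ) (ζ ^ (j : ℕ)) * ζ ^ (j : ℕ)) *
            (hartleyMode ζ m j : ℂ) * Complex.I by ring,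
        hconj, mul_one, ← Complex.ofReal_mul, Complex.re_ofReal_mul, Complex.I_re, mul_zero]
    rw [hin]
    simp only [Pi.smul_apply, Complex.real_smul, smul_eq_mul, lambdaMinus, ringFrequency]
    push_cast
    field_simp
    ring

/-- Rotation equivariance makes an equilibrium of the corotating field a rigidly rotating solution.
-/
theorem vortexField_rotate {N : ℕ} (f : ℝ → ℝ) (c : ℝ) {u : ℂ} (hu : ‖u‖ = 1) (x : Fin N → ℂ) :
    vortexField f c (u • x) = u • vortexField f c x := by
  funext j
  simp only [vortexField, Pi.smul_apply, smul_eq_mul, ← mul_sub, norm_mul, hu, one_mul,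
    mul_div_assoc, ← Finset.mul_sum]
  ring

theorem hasDerivAt_ringSolution (N : ℕ) (f : ℝ → ℝ) (c ω R : ℝ)
    (h : aggregationField f c ω (ringPolygon N R) = 0) (t : ℝ) :
    HasDerivAt (ringSolution N R ω) (vortexField f c (ringSolution N R ω t)) t := by
  have hsol : ∀ s, ringSolution N R ω s =
      Complex.exp (Complex.I * (ω : ℂ) * (s : ℂ)) • ringPolygon N R := fun s => rfl
  have hu : ‖Complex.exp (Complex.I * (ω : ℂ) * (t : ℂ))‖ = 1 := by
    rw [mul_assoc, mul_comm, ← Complex.ofReal_mul, Complex.norm_exp_ofReal_mul_I]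
  have hv : vortexField f c (ringPolygon N R) = (Complex.I * (ω : ℂ)) • ringPolygon N R := by
    have h2 := congrFun (corotatingField_eq (N := N) f c ω) (ringPolygon N R)
    simp only [h, smul_zero] at h2
    funext j
    exact sub_eq_zero.mp (congrFun h2 j)
  have hexp : HasDerivAt (fun s : ℝ => Complex.exp (Complex.I * (ω : ℂ) * (s : ℂ)))
      (Complex.exp (Complex.I * (ω : ℂ) * (t : ℂ)) * (Complex.I * (ω : ℂ))) t := by
    simpa using ((Complex.ofRealCLM.hasDerivAt (x := t)).const_mul (Complex.I * (ω : ℂ))).cexp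
  rw [hsol, vortexField_rotate f c hu, hv, smul_smul]
  exact hexp.smul_const (ringPolygon N R)

theorem charpoly_eq_of_polygonMode_eigen {N : ℕ} {ζ : ℂ} (hζ : IsPrimitiveRoot ζ N) (hN : N ≠ 0)
    (A : (Fin N → ℂ) →ₗ[ℝ] (Fin N → ℂ)) (a b : ℕ → ℝ)
    (ha : ∀ m : Fin N, A (polygonMode ζ m) = a m • polygonMode ζ m)
    (hb : ∀ m : Fin N, A (Complex.I • polygonMode ζ m) = b m • Complex.I • polygonMode ζ m) :
    A.charpoly = ∏ m ∈ Finset.range N,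
      (Polynomial.X - Polynomial.C (a m)) * (Polynomial.X - Polynomial.C (b m)) := by
  have : NeZero N := ⟨hN⟩
  set d : Fin 2 × Fin N → ℝ := fun p => if p.1 = 0 then a p.2 else b p.2 with hd
  have hdiag : LinearMap.toMatrix hζ.polygonBasis hζ.polygonBasis A = Matrix.diagonal d := by
    rw [← LinearMap.toMatrix_toLin hζ.polygonBasis hζ.polygonBasis (Matrix.diagonal d)]
    congr 1
    refine hζ.polygonBasis.ext fun p => ?_
    rw [Matrix.toLin_self, Finset.sum_eq_single p]
    · obtain ⟨i, m⟩ := p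
      fin_cases i
      · simpa [hζ.polygonBasis_zero, hd] using ha m
      · simpa [hζ.polygonBasis_one, hd] using hb m
    · intro q _ hq; simp [hq]
    · simp
  rw [← LinearMap.charpoly_toMatrix A hζ.polygonBasis, hdiag, Matrix.charpoly_diagonal,
    Fintype.prod_prod_type, Fin.prod_univ_two, ← Finset.prod_mul_distrib, Finset.prod_range]
  simp [hd]

/-! ### Linear systems that split into planes with zero diagonal. -/

open scoped TensorProduct

/-- The coordinates of `T x` when `T` preserves the coordinate planes of the pairs
`b (0, m), b (1, m)` and has zero diagonal. -/
theorem repr_apply_of_pairing {ι 𝕜 E : Type*} [CommRing 𝕜] [AddCommGroup E] [Module 𝕜 E]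
    (b : Module.Basis (Fin 2 × ι) 𝕜 E) (T : E →ₗ[𝕜] E) (p q : ι → 𝕜)
    (h0 : ∀ m, T (b (0, m)) = p m • b (1, m)) (h1 : ∀ m, T (b (1, m)) = -q m • b (0, m))
    (x : E) (m : ι) :
    b.repr (T x) (0, m) = -q m * b.repr x (1, m) ∧ b.repr (T x) (1, m) = p m * b.repr x (0, m) := by
  have e0 : b.coord (0, m) ∘ₗ T = -q m • b.coord (1, m) := by
    refine b.ext fun i => ?_
    obtain ⟨i, k⟩ := i
    fin_cases i
    · simp [h0]
    · by_cases hk : k = m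
      · simp [h1, hk]
      · simp [h1, hk]
  have e1 : b.coord (1, m) ∘ₗ T = p m • b.coord (0, m) := by
    refine b.ext fun i => ?_
    obtain ⟨i, k⟩ := i
    fin_cases i
    · by_cases hk : k = m
      · simp [h0, hk]
      · simp [h0, hk]
    · simp [h1]
  exact ⟨LinearMap.congr_fun e0 x, LinearMap.congr_fun e1 x⟩

theorem baseChange_apply_of_pairing
    {ι E : Type*} [NormedAddCommGroup E] [NormedSpace ℝ E]
    (b : Module.Basis (Fin 2 × ι) ℝ E) (L : E →L[ℝ] E) (p q : ι → ℝ)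
    (h0 : ∀ m, L (b (0, m)) = p m • b (1, m)) (h1 : ∀ m, L (b (1, m)) = -q m • b (0, m))
    (m : ι) :
    (L : E →ₗ[ℝ] E).baseChange ℂ (b.baseChange ℂ (0, m)) = (p m : ℂ) • b.baseChange ℂ (1, m) ∧
    (L : E →ₗ[ℝ] E).baseChange ℂ (b.baseChange ℂ (1, m)) = -(q m : ℂ) • b.baseChange ℂ (0, m) := by
  simp only [Module.Basis.baseChange_apply, LinearMap.baseChange_tmul,
    ContinuousLinearMap.coe_coe, h0, h1]
  have hs : ∀ (r : ℝ) (y : E), (1 : ℂ) ⊗ₜ[ℝ] (r • y) = (r : ℂ) • ((1 : ℂ) ⊗ₜ[ℝ] y) := by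
    intro r y
    rw [← TensorProduct.smul_tmul, TensorProduct.smul_tmul', Complex.real_smul, smul_eq_mul]
  exact ⟨hs _ _, by rw [hs, Complex.ofReal_neg]⟩

theorem sq_eq_of_isComplexEigenvalue
    {ι E : Type*} [NormedAddCommGroup E] [NormedSpace ℝ E]
    (b : Module.Basis (Fin 2 × ι) ℝ E) (L : E →L[ℝ] E) (p q : ι → ℝ)
    (h0 : ∀ m, L (b (0, m)) = p m • b (1, m)) (h1 : ∀ m, L (b (1, m)) = -q m • b (0, m))
    {μ : ℂ} (hμ : IsComplexEigenvalue L μ) :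
    ∃ m, μ ^ 2 = ((-(p m * q m) : ℝ) : ℂ) := by
  obtain ⟨x, hx⟩ := hμ.exists_hasEigenvector
  have hT := repr_apply_of_pairing (b.baseChange ℂ) ((L : E →ₗ[ℝ] E).baseChange ℂ)
    (fun m => (p m : ℂ)) (fun m => (q m : ℂ))
    (fun m => (baseChange_apply_of_pairing b L p q h0 h1 m).1)
    (fun m => (baseChange_apply_of_pairing b L p q h0 h1 m).2) x
  simp only [hx.apply_eq_smul, map_smul, Finsupp.smul_apply, smul_eq_mul] at hT
  have hne : (b.baseChange ℂ).repr x ≠ 0 := by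
    simpa using hx.2
  obtain ⟨⟨i, m⟩, him⟩ := Finsupp.ne_iff.mp hne
  refine ⟨m, ?_⟩
  obtain ⟨ha, hb⟩ := hT m
  have : ∀ i : Fin 2, (μ ^ 2 - ((-(p m * q m) : ℝ) : ℂ)) * (b.baseChange ℂ).repr x (i, m) = 0 := by
    intro i
    push_cast
    fin_cases i
    · simp only [Fin.zero_eta]
      linear_combination μ * ha - (q m : ℂ) * hb
    · simp only [Fin.mk_one]
      linear_combination μ * hb + (p m : ℂ) * ha
  exact sub_eq_zero.mp ((mul_eq_zero.mp (this i)).resolve_right him)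

theorem re_eq_zero_of_isComplexEigenvalue
    {ι E : Type*} [NormedAddCommGroup E] [NormedSpace ℝ E]
    (b : Module.Basis (Fin 2 × ι) ℝ E) (L : E →L[ℝ] E) (p q : ι → ℝ)
    (h0 : ∀ m, L (b (0, m)) = p m • b (1, m)) (h1 : ∀ m, L (b (1, m)) = -q m • b (0, m))
    (h : ∀ m, 0 ≤ p m * q m) {μ : ℂ}
    (hμ : IsComplexEigenvalue L μ) : μ.re = 0 := by
  obtain ⟨m, hm⟩ := sq_eq_of_isComplexEigenvalue b L p q h0 h1 hμ
  have hre := congrArg Complex.re hm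
  have him := congrArg Complex.im hm
  simp only [sq, Complex.mul_re, Complex.mul_im, Complex.ofReal_re, Complex.ofReal_im] at hre him
  by_contra hne
  have him0 : μ.im = 0 := by
    have : μ.re * μ.im = 0 := by linarith
    exact (mul_eq_zero.mp this).resolve_left hne
  rw [him0] at hre
  have := mul_self_pos.mpr hne
  linarith [h m]

theorem exists_isComplexEigenvalue_re_pos
    {ι E : Type*} [NormedAddCommGroup E] [NormedSpace ℝ E]
    (b : Module.Basis (Fin 2 × ι) ℝ E) (L : E →L[ℝ] E) (p q : ι → ℝ)
    (h0 : ∀ m, L (b (0, m)) = p m • b (1, m)) (h1 : ∀ m, L (b (1, m)) = -q m • b (0, m))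
    {m : ι} (hp : 0 < p m) (hq : q m < 0) :
    ∃ μ : ℂ, IsComplexEigenvalue L μ ∧ 0 < μ.re := by
  have hpq : 0 < -(p m * q m) := by nlinarith
  have hs : ((Real.sqrt (-(p m * q m)) : ℝ) : ℂ) ^ 2 = -((p m : ℂ) * (q m : ℂ)) := by
    rw [← Complex.ofReal_pow, Real.sq_sqrt hpq.le]
    push_cast
    ring
  have hb := baseChange_apply_of_pairing b L p q h0 h1 m
  refine ⟨(Real.sqrt (-(p m * q m)) : ℝ), ?_, by simpa using hpq⟩
  set μ : ℂ := ((Real.sqrt (-(p m * q m)) : ℝ) : ℂ)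
  -- With `μ² = -pq`, the vector `-q e₀ + μ e₁` satisfies `T v = μ v`; it is nonzero because `q ≠
  -- 0`.
  refine Module.End.hasEigenvalue_of_hasEigenvector
    (x := -(q m : ℂ) • b.baseChange ℂ (0, m) + μ • b.baseChange ℂ (1, m))
    ⟨Module.End.mem_eigenspace_iff.mpr ?_, ?_⟩
  · rw [map_add, map_smul, map_smul, hb.1, hb.2, smul_add, smul_smul, smul_smul,
      smul_smul, ← sq, hs, add_comm]
    congr 2
    ring
  · intro h
    have h2 := congrArg (fun y => (b.baseChange ℂ).repr y (0, m)) h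
    simp only [map_add, map_smul, Module.Basis.repr_self, Finsupp.add_apply, Finsupp.smul_apply,
      map_zero, Finsupp.zero_apply] at h2
    simp [hq.ne] at h2

/-- For `p = 0` and `q ≠ 0` the plane carries a nilpotent Jordan block, and the solution `e₁ - t q
e₀` grows linearly. The growth is in a `(0, m)` coordinate, which no multiple of a vector `b (1, i)`
can cancel. -/
theorem not_bounded_of_pairing_eq_zero
    {ι E : Type*} [Fintype ι] [NormedAddCommGroup E] [NormedSpace ℝ E]
    (b : Module.Basis (Fin 2 × ι) ℝ E) (L : E →L[ℝ] E) (p q : ι → ℝ)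
    (h0 : ∀ m, L (b (0, m)) = p m • b (1, m)) (h1 : ∀ m, L (b (1, m)) = -q m • b (0, m))
    {m : ι} (hp : p m = 0) (hq : q m < 0) {i : ι} (r : ℝ) :
    ¬ ∃ K : ℝ, ∀ η : ℝ → E, (∀ t : ℝ, HasDerivAt η (L (η t)) t) →
      ∀ t : ℝ, 0 ≤ t → ∃ s : ℝ, ‖η t - s • r • b (1, i)‖ ≤ K * ‖η 0‖ := by
  rintro ⟨K, hK⟩
  have : FiniteDimensional ℝ E := b.finiteDimensional_of_finite
  set φ : E →L[ℝ] ℝ := (b.coord (0, m)).toContinuousLinearMap with hφ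
  have hφ0 : ∀ k, φ (b (1, k)) = 0 := fun k => by simp [hφ]
  have hφ1 : φ (b (0, m)) = 1 := by simp [hφ]
  set η : ℝ → E := fun t => b (1, m) + t • (-q m • b (0, m)) with hη
  have hηd : ∀ t : ℝ, HasDerivAt η (L (η t)) t := by
    intro t
    have h : HasDerivAt η ((1 : ℝ) • (-q m • b (0, m))) t :=
      ((hasDerivAt_id t).smul_const (-q m • b (0, m))).const_add (b (1, m))
    refine h.congr_deriv ?_
    simp [hη, h0, h1, hp]
  set B := ‖φ‖ * (K * ‖η 0‖) with hB
  have hBt : ∀ t : ℝ, 0 ≤ t → t * -q m ≤ B := by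
    intro t ht
    obtain ⟨s, hs⟩ := hK η hηd t ht
    have e : φ (η t - s • r • b (1, i)) = t * -q m := by
      simp [hη, hφ0, hφ1]
    calc t * -q m = φ (η t - s • r • b (1, i)) := e.symm
      _ ≤ ‖φ (η t - s • r • b (1, i))‖ := Real.le_norm_self _
      _ ≤ ‖φ‖ * ‖η t - s • r • b (1, i)‖ := φ.le_opNorm _
      _ ≤ B := mul_le_mul_of_nonneg_left hs (norm_nonneg _)
  have hB0 : 0 ≤ B := by simpa using hBt 0 le_rfl
  -- At this time the growing coordinate equals `B + 1`.
  have h2 := hBt ((B + 1) / -q m) (div_nonneg (by linarith) (by linarith))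
  rw [div_mul_cancel₀ _ (by linarith : -q m ≠ 0)] at h2
  linarith

/-- Solutions of the oscillator `u' = -q w`, `w' = p u` with `p, q < 0` stay bounded. -/
theorem oscillator_bound {p q : ℝ} (hp : p < 0) (hq : q < 0) {u w : ℝ → ℝ}
    (hu : ∀ t, HasDerivAt u (-q * w t) t) (hw : ∀ t, HasDerivAt w (p * u t) t) (t : ℝ) :
    u t ^ 2 ≤ (1 + q / p) * (u 0 ^ 2 + w 0 ^ 2) ∧ w t ^ 2 ≤ (1 + p / q) * (u 0 ^ 2 + w 0 ^ 2) := by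
  -- The energy `p u² + q w²` is conserved and definite, as `p` and `q` have the same sign.
  have hd : ∀ s, HasDerivAt (fun s => p * u s ^ 2 + q * w s ^ 2) 0 s := by
    intro s
    refine ((((hu s).pow 2).const_mul p).add (((hw s).pow 2).const_mul q)).congr_deriv ?_
    ring
  have hc : p * u t ^ 2 + q * w t ^ 2 = p * u 0 ^ 2 + q * w 0 ^ 2 :=
    is_const_of_deriv_eq_zero (fun s => (hd s).differentiableAt) (fun s => (hd s).deriv) t 0
  have hqp : 0 < q / p := div_pos_of_neg_of_neg hq hp
  have hpq : 0 < p / q := div_pos_of_neg_of_neg hp hq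
  have e1 : u t ^ 2 + q / p * w t ^ 2 = u 0 ^ 2 + q / p * w 0 ^ 2 := by
    have := hp.ne
    field_simp
    linarith
  have e2 : p / q * u t ^ 2 + w t ^ 2 = p / q * u 0 ^ 2 + w 0 ^ 2 := by
    have := hq.ne
    field_simp
    linarith
  constructor
  · nlinarith [mul_nonneg hqp.le (sq_nonneg (w t)), mul_nonneg hqp.le (sq_nonneg (u 0)),
      sq_nonneg (w 0)]
  · nlinarith [mul_nonneg hpq.le (sq_nonneg (u t)), mul_nonneg hpq.le (sq_nonneg (w 0)),
      sq_nonneg (u 0)]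

/-- In the exceptional plane the coordinate `(0, i)` is constant and drives a possible linear drift
of `(1, i)`, which is the direction factored out. All other planes are oscillators with a definite
conserved energy. -/
theorem bounded_of_pairing_neg
    {ι E : Type*} [Fintype ι] [NormedAddCommGroup E] [NormedSpace ℝ E]
    (b : Module.Basis (Fin 2 × ι) ℝ E) (L : E →L[ℝ] E) (p q : ι → ℝ)
    (h0 : ∀ m, L (b (0, m)) = p m • b (1, m)) (h1 : ∀ m, L (b (1, m)) = -q m • b (0, m))
    {i : ι} (hqi : q i = 0) (hq : ∀ m, m ≠ i → q m < 0)
    (hp : ∀ m, m ≠ i → p m < 0) {r : ℝ} (hr : r ≠ 0) :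
    ∃ K : ℝ, ∀ η : ℝ → E, (∀ t : ℝ, HasDerivAt η (L (η t)) t) →
      ∀ t : ℝ, 0 ≤ t → ∃ s : ℝ, ‖η t - s • r • b (1, i)‖ ≤ K * ‖η 0‖ := by
  have : FiniteDimensional ℝ E := b.finiteDimensional_of_finite
  set φ : Fin 2 × ι → E →L[ℝ] ℝ := fun k => (b.coord k).toContinuousLinearMap with hφ
  have hφa : ∀ k x, φ k x = b.repr x k := fun k x => rfl
  have hd : ∀ η : ℝ → E, (∀ t : ℝ, HasDerivAt η (L (η t)) t) → ∀ (m : ι) (t : ℝ),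
      HasDerivAt (fun t => φ (0, m) (η t)) (-q m * φ (1, m) (η t)) t ∧
      HasDerivAt (fun t => φ (1, m) (η t)) (p m * φ (0, m) (η t)) t := by
    intro η hη m t
    have hT := repr_apply_of_pairing b (L : E →ₗ[ℝ] E) p q h0 h1 (η t) m
    exact ⟨((φ (0, m)).hasFDerivAt.comp_hasDerivAt t (hη t)).congr_deriv hT.1,
      ((φ (1, m)).hasFDerivAt.comp_hasDerivAt t (hη t)).congr_deriv hT.2⟩
  have hcoord : ∀ k : Fin 2 × ι, ∃ K : ℝ, ∀ η : ℝ → E, (∀ t : ℝ, HasDerivAt η (L (η t)) t) →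
      ∀ t : ℝ, k ≠ (1, i) → |φ k (η t)| ≤ K * ‖η 0‖ := by
    rintro ⟨a, m⟩
    by_cases hm : m = i
    · subst hm
      refine ⟨‖φ (0, m)‖, fun η hη t ha => ?_⟩
      have ha0 : a = 0 := by
        fin_cases a
        · rfl
        · exact absurd rfl ha
      subst ha0
      have hc : φ (0, m) (η t) = φ (0, m) (η 0) :=
        is_const_of_deriv_eq_zero (f := fun t => φ (0, m) (η t))
          (fun s => (hd η hη m s).1.differentiableAt)
          (fun s => by rw [(hd η hη m s).1.deriv, hqi]; simp) t 0
      rw [hc]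
      exact (φ (0, m)).le_opNorm (η 0)
    · set C := ‖φ (0, m)‖ ^ 2 + ‖φ (1, m)‖ ^ 2 with hC
      set M := (1 + q m / p m) + (1 + p m / q m) with hM
      have hqp : 0 < q m / p m := div_pos_of_neg_of_neg (hq m hm) (hp m hm)
      have hpq : 0 < p m / q m := div_pos_of_neg_of_neg (hp m hm) (hq m hm)
      refine ⟨Real.sqrt (M * C), fun η hη t _ => ?_⟩
      have ho := oscillator_bound (hp m hm) (hq m hm) (fun s => (hd η hη m s).1)
        (fun s => (hd η hη m s).2) t
      have hsq : ∀ k, φ k (η 0) ^ 2 ≤ ‖φ k‖ ^ 2 * ‖η 0‖ ^ 2 := fun k => by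
        rw [← mul_pow, ← sq_abs]
        exact pow_le_pow_left₀ (abs_nonneg _) ((φ k).le_opNorm (η 0)) 2
      have hin : φ (0, m) (η 0) ^ 2 + φ (1, m) (η 0) ^ 2 ≤ C * ‖η 0‖ ^ 2 := by
        rw [hC, add_mul]
        exact add_le_add (hsq _) (hsq _)
      have hin0 : 0 ≤ φ (0, m) (η 0) ^ 2 + φ (1, m) (η 0) ^ 2 := by positivity
      have hM0 : 0 ≤ M := by linarith
      have key : φ (a, m) (η t) ^ 2 ≤ M * C * ‖η 0‖ ^ 2 := by
        have h3 : φ (a, m) (η t) ^ 2 ≤ M * (φ (0, m) (η 0) ^ 2 + φ (1, m) (η 0) ^ 2) := by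
          fin_cases a
          · refine ho.1.trans (mul_le_mul_of_nonneg_right ?_ hin0)
            linarith
          · refine ho.2.trans (mul_le_mul_of_nonneg_right ?_ hin0)
            linarith
        rw [mul_assoc]
        exact h3.trans (mul_le_mul_of_nonneg_left hin hM0)
      calc |φ (a, m) (η t)| ≤ Real.sqrt (M * C * ‖η 0‖ ^ 2) := Real.abs_le_sqrt key
        _ = Real.sqrt (M * C) * ‖η 0‖ := by
          rw [Real.sqrt_mul (by positivity), Real.sqrt_sq (norm_nonneg _)]
  choose K hK using hcoord
  classical
  -- The multiple `s` removes the coordinate `(1, i)` exactly; the bounds of the other coordinates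
  -- add up.
  refine ⟨∑ k ∈ Finset.univ.erase ((1, i) : Fin 2 × ι), K k * ‖b k‖, fun η hη t _ =>
    ⟨b.repr (η t) (1, i) / r, ?_⟩⟩
  have e : η t - (b.repr (η t) (1, i) / r) • r • b (1, i) =
      ∑ k ∈ Finset.univ.erase ((1, i) : Fin 2 × ι), b.repr (η t) k • b k := by
    rw [smul_smul, div_mul_cancel₀ _ hr]
    nth_rewrite 1 [← b.sum_repr (η t)]
    rw [← Finset.add_sum_erase _ _ (Finset.mem_univ ((1, i) : Fin 2 × ι)), add_sub_cancel_left]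
  rw [e, Finset.sum_mul]
  refine norm_sum_le_of_le _ fun k hk => ?_
  rw [norm_smul, Real.norm_eq_abs, mul_right_comm]
  exact mul_le_mul_of_nonneg_right (hK k η hη t (Finset.ne_of_mem_erase hk)) (norm_nonneg _)

theorem isLinearlyStable_iff_of_pairing
    {ι E : Type*} [Fintype ι] [NormedAddCommGroup E] [NormedSpace ℝ E]
    (b : Module.Basis (Fin 2 × ι) ℝ E) (L : E →L[ℝ] E) (p q : ι → ℝ)
    (h0 : ∀ m, L (b (0, m)) = p m • b (1, m)) (h1 : ∀ m, L (b (1, m)) = -q m • b (0, m))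
    {F : E → E} {x : E} (hF : HasFDerivAt F L x) {i : ι}
    (hqi : q i = 0) (hq : ∀ m, m ≠ i → q m < 0) {r : ℝ} (hr : r ≠ 0) :
    IsLinearlyStable F x (r • b (1, i)) ↔ ∀ m, m ≠ i → p m < 0 := by
  constructor
  · rintro ⟨L', hL', hre, hbd⟩ m hm
    obtain rfl := hF.unique hL'
    rcases lt_trichotomy (p m) 0 with h | h | h
    · exact h
    · exact absurd hbd (not_bounded_of_pairing_eq_zero b L p q h0 h1 h (hq m hm) r)
    · obtain ⟨μ, hμ, hpos⟩ := exists_isComplexEigenvalue_re_pos b L p q h0 h1 h (hq m hm)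
      exact absurd (hre μ hμ) hpos.ne'
  · intro hp
    refine ⟨L, hF, fun μ hμ => re_eq_zero_of_isComplexEigenvalue b L p q h0 h1 (fun m => ?_) hμ,
      bounded_of_pairing_neg b L p q h0 h1 hqi hq hp hr⟩
    by_cases hm : m = i
    · rw [hm, hqi, mul_zero]
    · exact (mul_pos_of_neg_of_neg (hp m hm) (hq m hm)).le

/-! ### Stability of the ring in terms of `λ₊`. -/

theorem isPrimitiveRoot_ring {N : ℕ} (hN : N ≠ 0) :
    IsPrimitiveRoot (Complex.exp (2 * (Real.pi : ℂ) * Complex.I / (N : ℂ))) N :=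
  Complex.isPrimitiveRoot_exp N hN

theorem lambdaMinus_zero (N : ℕ) (c R : ℝ) : lambdaMinus N c R 0 = 0 := by
  simp [lambdaMinus]

theorem lambdaMinus_neg {N : ℕ} {c R : ℝ} (hc : 0 < c) (hR : 0 < R) {m : ℕ} (hm0 : 1 ≤ m)
    (hm : m < N) : lambdaMinus N c R m < 0 := by
  have h1 : (1 : ℝ) ≤ m := by exact_mod_cast hm0
  have h2 : (m : ℝ) + 1 ≤ N := by exact_mod_cast hm
  refine mul_neg_of_pos_of_neg (by positivity) ?_
  nlinarith [mul_nonneg (sub_nonneg.mpr h1) (sub_nonneg.mpr h2)]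

/-- The linearization of the vortex system at the ring, in the corotating frame. -/
theorem exists_hasFDerivAt_corotatingField {N : ℕ} [NeZero N] {f : ℝ → ℝ} (c : ℝ) {R : ℝ}
    (hR : 0 < R) (hf : DifferentiableAt ℝ f R) :
    ∃ (b : Module.Basis (Fin 2 × Fin N) ℝ (Fin N → ℂ)) (L : (Fin N → ℂ) →L[ℝ] (Fin N → ℂ)),
      HasFDerivAt (corotatingField f c (ringFrequency N f c R)) L (ringPolygon N R) ∧
      (∀ m, L (b (0, m)) = lambdaPlus N f c R m • b (1, m)) ∧
      (∀ m, L (b (1, m)) = -lambdaMinus N c R m • b (0, m)) ∧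
      Complex.I • ringPolygon N R = R • b (1, 0) := by
  have hζ := isPrimitiveRoot_ring (NeZero.ne N)
  obtain ⟨A, hA, hp, hm⟩ := exists_hasFDerivAt_aggregationField hζ (NeZero.ne N) c hR hf
  simp only [← ringPolygon_eq] at hA
  refine ⟨hζ.polygonBasis, Complex.I • A, ?_, fun m => ?_, fun m => ?_, ?_⟩
  · rw [corotatingField_eq]
    exact hA.const_smul Complex.I
  · rw [hζ.polygonBasis_zero, hζ.polygonBasis_one, smul_apply, hp, smul_comm]
  · rw [hζ.polygonBasis_zero, hζ.polygonBasis_one, smul_apply, hm, smul_comm,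
      smul_smul, Complex.I_mul_I, neg_smul, neg_smul, one_smul, smul_neg]
  -- The Hartley mode `0` is constant `1`, so the tangential mode `0` is the infinitesimal rotation
  -- divided by `R`.
  · rw [hζ.polygonBasis_one]
    funext j
    rw [Pi.smul_apply, Pi.smul_apply, Pi.smul_apply, ringPolygon_eq, polygonMode,
      hartleyMode_zero _ _ _ (Fin.val_zero N), Complex.real_smul, smul_eq_mul, smul_eq_mul]
    push_cast
    ring

theorem ringIsStable_iff {N : ℕ} (hN : 2 ≤ N) {c : ℝ} (hc : 0 < c) {f : ℝ → ℝ} {R : ℝ}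
    (hR : 0 < R) (hf : DifferentiableAt ℝ f R) :
    RingIsStable N f c R ↔ ∀ m : ℕ, 1 ≤ m → m < N → lambdaPlus N f c R m < 0 := by
  have : NeZero N := ⟨by omega⟩
  obtain ⟨b, L, hL, h0, h1, hv⟩ := exists_hasFDerivAt_corotatingField (N := N) c hR hf
  rw [RingIsStable, hv, isLinearlyStable_iff_of_pairing b L _ _ h0 h1 hL (lambdaMinus_zero N c R)
    (fun m hm => lambdaMinus_neg hc hR (Nat.one_le_iff_ne_zero.mpr (Fin.val_ne_zero_iff.mpr hm))
      m.2) hR.ne']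
  constructor
  · intro h m hm0 hm
    exact h ⟨m, hm⟩ (Fin.val_ne_zero_iff.mp (Nat.one_le_iff_ne_zero.mp hm0))
  · intro h m hm
    exact h m (Nat.one_le_iff_ne_zero.mpr (Fin.val_ne_zero_iff.mpr hm)) m.2

theorem ringIsUnstable_of_lambdaPlus_pos {N : ℕ} {c : ℝ} (hc : 0 < c) {f : ℝ → ℝ}
    {R : ℝ} (hR : 0 < R) (hf : DifferentiableAt ℝ f R) {m : ℕ} (hm0 : 1 ≤ m) (hm : m < N)
    (hpos : 0 < lambdaPlus N f c R m) : RingIsUnstable N f c R := by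
  have : NeZero N := ⟨by omega⟩
  obtain ⟨b, L, hL, h0, h1, -⟩ := exists_hasFDerivAt_corotatingField (N := N) c hR hf
  exact ⟨L, hL, exists_isComplexEigenvalue_re_pos b L _ _ h0 h1 (m := ⟨m, hm⟩) hpos
    (lambdaMinus_neg hc hR hm0 hm)⟩

theorem ring_stability_of_max {N : ℕ} (hN : 2 ≤ N) {c : ℝ} (hc : 0 < c) {f : ℝ → ℝ} {R P : ℝ}
    (hR : 0 < R) (hf : DifferentiableAt ℝ f R) {m₀ : ℕ} (hm0 : 1 ≤ m₀) (hm : m₀ < N)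
    (hP : lambdaPlus N f c R m₀ = P) (hmax : ∀ m : ℕ, lambdaPlus N f c R m ≤ P) :
    (RingIsStable N f c R ↔ P < 0) ∧ (0 < P → RingIsUnstable N f c R) := by
  rw [ringIsStable_iff hN hc hR hf]
  refine ⟨⟨fun h => hP ▸ h m₀ hm0 hm, fun h m _ _ => (hmax m).trans_lt h⟩, fun h => ?_⟩
  exact ringIsUnstable_of_lambdaPlus_pos hc hR hf hm0 hm (hP ▸ h)

/-! ### The threshold `P` and generic instability. -/

/-- Completing the square, `4(m-1)(N-m-1) = (N-2)² - (2m-N)²`. For odd `N` the last square is at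
least `1`, with equality at `m = (N-1)/2`; for even `N` it vanishes at `m = N/2`. -/
theorem lambdaPlus_eq_odd (N : ℕ) (f : ℝ → ℝ) (c : ℝ) {R : ℝ} (hR : 0 < R) (m : ℕ) :
    lambdaPlus N f c R m = deriv f R * R + c / (8 * R ^ 2) * (((N : ℝ) - 1) * ((N : ℝ) - 7)) -
      c / (8 * R ^ 2) * ((2 * (m : ℝ) - N) ^ 2 - 1) := by
  rw [lambdaPlus]
  field_simp
  ring

theorem lambdaPlus_eq_even (N : ℕ) (f : ℝ → ℝ) (c : ℝ) {R : ℝ} (hR : 0 < R) (m : ℕ) :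
    lambdaPlus N f c R m = deriv f R * R + c / (8 * R ^ 2) * ((N : ℝ) ^ 2 - 8 * (N : ℝ) + 8) -
      c / (8 * R ^ 2) * (2 * (m : ℝ) - N) ^ 2 := by
  rw [lambdaPlus]
  field_simp
  ring

theorem ring_stability_odd {N : ℕ} (hN : 2 ≤ N) (hodd : Odd N) {c : ℝ} (hc : 0 < c) {f : ℝ → ℝ}
    {R : ℝ} (hR : 0 < R) (hf : DifferentiableAt ℝ f R) :
    (RingIsStable N f c R ↔
      deriv f R * R + c / (8 * R ^ 2) * (((N : ℝ) - 1) * ((N : ℝ) - 7)) < 0) ∧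
    (0 < deriv f R * R + c / (8 * R ^ 2) * (((N : ℝ) - 1) * ((N : ℝ) - 7)) →
      RingIsUnstable N f c R) := by
  obtain ⟨k, hk⟩ := hodd
  refine ring_stability_of_max hN hc hR hf (m₀ := k) (by omega) (by omega) ?_ fun m => ?_
  · rw [lambdaPlus_eq_odd N f c hR, hk]
    push_cast
    ring
  · rw [lambdaPlus_eq_odd N f c hR]
    have h1 : (1 : ℤ) ≤ (2 * (m : ℤ) - N) ^ 2 := by
      have : (2 * (m : ℤ) - N) ≠ 0 := by omega
      have := sq_pos_of_ne_zero this
      omega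
    have h2 : (1 : ℝ) ≤ (2 * (m : ℝ) - N) ^ 2 := by exact_mod_cast h1
    have h3 : 0 ≤ c / (8 * R ^ 2) * ((2 * (m : ℝ) - N) ^ 2 - 1) :=
      mul_nonneg (by positivity) (by linarith)
    linarith

theorem ring_stability_even {N : ℕ} (hN : 2 ≤ N) (heven : Even N) {c : ℝ} (hc : 0 < c)
    {f : ℝ → ℝ} {R : ℝ} (hR : 0 < R) (hf : DifferentiableAt ℝ f R) :
    (RingIsStable N f c R ↔
      deriv f R * R + c / (8 * R ^ 2) * ((N : ℝ) ^ 2 - 8 * (N : ℝ) + 8) < 0) ∧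
    (0 < deriv f R * R + c / (8 * R ^ 2) * ((N : ℝ) ^ 2 - 8 * (N : ℝ) + 8) →
      RingIsUnstable N f c R) := by
  obtain ⟨k, hk⟩ := heven
  refine ring_stability_of_max hN hc hR hf (m₀ := k) (by omega) (by omega) ?_ fun m => ?_
  · rw [lambdaPlus_eq_even N f c hR, hk]
    push_cast
    ring
  · rw [lambdaPlus_eq_even N f c hR]
    have h3 : 0 ≤ c / (8 * R ^ 2) * (2 * (m : ℝ) - N) ^ 2 := by positivity
    linarith

theorem ringIsUnstable_of_deriv_nonneg {N : ℕ} (hN : 7 ≤ N) {c : ℝ} (hc : 0 < c) {f : ℝ → ℝ}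
    {R : ℝ} (hR : 0 < R) (hf : DifferentiableAt ℝ f R) (hd : 0 ≤ deriv f R)
    (h : 8 ≤ N ∨ 0 < deriv f R) : RingIsUnstable N f c R := by
  have hc8 : 0 < c / (8 * R ^ 2) := by positivity
  have h7 : (7 : ℝ) ≤ N := by exact_mod_cast hN
  -- The interaction part of `P` is positive for `N ≥ 8` and zero for `N = 7`, where the sign of
  -- `f'(R)` decides.
  rcases Nat.even_or_odd N with he | ho
  · refine (ring_stability_even (by omega) he hc hR hf).2 ?_
    have h8 : (8 : ℝ) ≤ N := by
      have : 8 ≤ N := by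
        obtain ⟨k, hk⟩ := he
        omega
      exact_mod_cast this
    have : 0 < c / (8 * R ^ 2) * ((N : ℝ) ^ 2 - 8 * (N : ℝ) + 8) :=
      mul_pos hc8 (by nlinarith)
    linarith [mul_nonneg hd hR.le]
  · refine (ring_stability_odd (by omega) ho hc hR hf).2 ?_
    rcases h with h | h
    · have h8 : (8 : ℝ) ≤ N := by exact_mod_cast h
      have : 0 < c / (8 * R ^ 2) * (((N : ℝ) - 1) * ((N : ℝ) - 7)) :=
        mul_pos hc8 (mul_pos (by linarith) (by linarith))
      linarith [mul_nonneg hd hR.le]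
    · have : 0 ≤ c / (8 * R ^ 2) * (((N : ℝ) - 1) * ((N : ℝ) - 7)) :=
        mul_nonneg hc8.le (mul_nonneg (by linarith) (by linarith))
      linarith [mul_pos h hR]

/-- Openness is continuity of `f'`. If density failed, `f' ≤ 0` on some ball inside `S`, so `f`
would be antitone there, against strict monotonicity. -/
theorem isOpen_dense_deriv_pos {f : ℝ → ℝ} {S : Set ℝ} (hS : IsOpen S)
    (hf : ContDiffOn ℝ 1 f S) (hmono : StrictMonoOn f S) :
    IsOpen {x ∈ S | 0 < deriv f x} ∧ S ⊆ closure {x ∈ S | 0 < deriv f x} := by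
  refine ⟨(hf.continuousOn_deriv_of_isOpen hS le_rfl).isOpen_inter_preimage hS isOpen_Ioi,
    fun x hx => mem_closure_iff.mpr fun V hV hxV => ?_⟩
  obtain ⟨ε, hε, hball⟩ := Metric.isOpen_iff.mp (hV.inter hS) x ⟨hxV, hx⟩
  by_contra hne
  have hsub : Metric.ball x ε ⊆ S := fun y hy => (hball hy).2
  have hanti : AntitoneOn f (Metric.ball x ε) := by
    refine antitoneOn_of_deriv_nonpos (convex_ball x ε) (hf.continuousOn.mono hsub)
      (((hf.differentiableOn one_ne_zero).mono hsub).mono interior_subset) fun y hy => ?_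
    by_contra hpos
    have hy' := hball (interior_subset hy)
    exact hne ⟨y, hy'.1, hy'.2, not_le.mp hpos⟩
  have hxb : x ∈ Metric.ball x ε := Metric.mem_ball_self hε
  have hyb : x + ε / 2 ∈ Metric.ball x ε := by
    rw [Metric.mem_ball, Real.dist_eq, add_sub_cancel_left, abs_of_pos (by linarith)]
    linarith
  have hlt : x < x + ε / 2 := by linarith
  exact absurd (hmono (hsub hxb) (hsub hyb) hlt) (not_lt.mpr (hanti hxb hyb hlt.le))

theorem theorem2 (N : ℕ) (hN : 2 ≤ N) (c : ℝ) (hc : 0 < c) :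
    (∀ (f : ℝ → ℝ) (R : ℝ), 0 < R → DifferentiableAt ℝ f R →
      -- the ring is a solution of the vortex system
      (∀ t : ℝ, HasDerivAt (ringSolution N R (ringFrequency N f c R))
        (vortexField f c (ringSolution N R (ringFrequency N f c R) t)) t) ∧
      -- eigenvalues, with multiplicity, of the linearized aggregation system at the ring
      (∃ A : (Fin N → ℂ) →L[ℝ] (Fin N → ℂ),
        aggregationField f c (ringFrequency N f c R) (ringPolygon N R) = 0 ∧
        HasFDerivAt (aggregationField f c (ringFrequency N f c R)) A (ringPolygon N R) ∧
        (A : (Fin N → ℂ) →ₗ[ℝ] (Fin N → ℂ)).charpoly =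
          ∏ m ∈ Finset.range N,
            (Polynomial.X - Polynomial.C (lambdaPlus N f c R m)) *
              (Polynomial.X - Polynomial.C (lambdaMinus N c R m))) ∧
      (Odd N →
        (RingIsStable N f c R ↔
          deriv f R * R + c / (8 * R ^ 2) * (((N : ℝ) - 1) * ((N : ℝ) - 7)) < 0) ∧
        (0 < deriv f R * R + c / (8 * R ^ 2) * (((N : ℝ) - 1) * ((N : ℝ) - 7)) →
          RingIsUnstable N f c R)) ∧
      (Even N →
        (RingIsStable N f c R ↔
          deriv f R * R + c / (8 * R ^ 2) * ((N : ℝ) ^ 2 - 8 * (N : ℝ) + 8) < 0) ∧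
        (0 < deriv f R * R + c / (8 * R ^ 2) * ((N : ℝ) ^ 2 - 8 * (N : ℝ) + 8) →
          RingIsUnstable N f c R))) ∧
    -- generic instability for at least seven vortices and increasing precession frequency
    (7 ≤ N → ∀ (f : ℝ → ℝ) (S : Set ℝ), IsOpen S → S ⊆ Set.Ioi 0 →
      ContDiffOn ℝ 1 f S → StrictMonoOn f S →
      (∀ R ∈ S, (8 ≤ N ∨ 0 < deriv f R) → RingIsUnstable N f c R) ∧
      ∃ U : Set ℝ, IsOpen U ∧ U ⊆ S ∧ S ⊆ closure U ∧ ∀ R ∈ U, RingIsUnstable N f c R) := by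
  have hN0 : N ≠ 0 := by omega
  refine ⟨fun f R hR hf => ⟨?_, ?_, fun ho => ring_stability_odd hN ho hc hR hf,
    fun he => ring_stability_even hN he hc hR hf⟩, fun h7 f S hS hpos hf hmono => ?_⟩
  · have hζ := isPrimitiveRoot_ring hN0
    have heq := aggregationField_polygon_eq_zero hζ f c hR
    simp only [← ringPolygon_eq] at heq
    exact hasDerivAt_ringSolution N f c _ R heq
  · have hζ := isPrimitiveRoot_ring hN0
    have heq := aggregationField_polygon_eq_zero hζ f c hR
    obtain ⟨A, hA, hp, hm⟩ := exists_hasFDerivAt_aggregationField hζ hN0 c hR hf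
    simp only [← ringPolygon_eq] at heq hA
    exact ⟨A, heq, hA, charpoly_eq_of_polygonMode_eigen hζ hN0 _ _ _ hp hm⟩
  · have hdiff : ∀ R ∈ S, DifferentiableAt ℝ f R := fun R hR =>
      (hf.differentiableOn one_ne_zero).differentiableAt (hS.mem_nhds hR)
    have hun : ∀ R ∈ S, (8 ≤ N ∨ 0 < deriv f R) → RingIsUnstable N f c R := by
      intro R hR h
      refine ringIsUnstable_of_deriv_nonneg h7 hc (hpos hR) (hdiff R hR) ?_ h
      rw [← derivWithin_of_isOpen hS hR]
      exact hmono.monotoneOn.derivWithin_nonneg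
    obtain ⟨hopen, hdense⟩ := isOpen_dense_deriv_pos hS hf hmono
    exact ⟨hun, _, hopen, fun R hR => hR.1, hdense, fun R hR => hun R hR.1 (Or.inr hR.2)⟩
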